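/- Lemma 5.1. Let $\mathcal T^d=(\mathbb R/\mathbb Z)^d$ be the $d$-dimensional torus with $|\mathcal T^d|=1$, let $\kappa>0$, $c\ge 0$, and let the reaction coefficient $k=k(t,x)$ (which may depend on $(t,x)$ also through the solution) satisfy $0<\underline k\le k\le\overline k$ with constants $\underline k,\overline k$. Let $(n,p,e)$ be a global classical solution of $$\partial_t n=\kappa\Delta n+k(e-np),\qquad \partial_t p=\kappa\Delta p+k(e-np),\qquad \partial_t e=\kappa\Delta e$$ on $\mathcal T^d$ with initial data $(n_0,p_0,e_0)\in L^\infty(\mathcal T^d)^3$; that is, $n,p,e$ are of class $C^{1,2}$ on $(0,\infty)\times\mathcal T^d$, bounded on $(0,T]\times\mathcal T^d$ for every $T<\infty$, satisfy the equations pointwise for $t>0$, and converge in $L^1(\mathcal T^d)$ to $n_0,p_0,e_0$ as $t\to0^+$. Assume that $n_0,p_0\ge0$ and $0<\underline e\le e_0\le\overline e$ almost everywhere with constants $\underline e,\overline e$, and put $$\int_{\mathcal T^d}(n_0-p_0)\,dx=\mathbf C_0,\qquad \int_{\mathcal T^d}e_0\,dx=E_0=:e^*.$$ Let $C_n,C_p>0$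 be determined by $C_nC_p=1$ and $C_n-C_p=\mathbf C_0/\sqrt{e^*}$, and assume that the initial relative entropy $\mathcal H(n_0,p_0,e_0)$ is finite, where, with $\lambda_B(\nu)=\nu\ln\nu-\nu+1$ and $\lambda_B(0)=1$, $$\mathcal H(n,p,e)=\int_{\mathcal T^d}\Big( C_n\sqrt e\,\lambda_B\big(\tfrac{n}{C_n\sqrt e}\big)+C_p\sqrt e\,\lambda_B\big(\tfrac{p}{C_p\sqrt e}\big)+\tfrac{c+C_n+C_p}{2\sqrt{e^*}}\big(\sqrt e-\sqrt{e^*}\big)^2\Big)dx .$$ Then $$\sup_{t\ge0}\big(\|n(t)\|_{L^1(\mathcal T^d)}+\|p(t)\|_{L^1(\mathcal T^d)}\big)<\infty .$$ -/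

import Mathlib

open MeasureTheory Set Filter Topology

/-- The `d`-dimensional torus `(ℝ/ℤ)^d`; its `volume` is the normalized Haar measure, so that the
torus has measure one. -/
abbrev Torus (d : ℕ) : Type := UnitAddTorus (Fin d)

theorem torus_volume_univ (d : ℕ) : volume (univ : Set (Torus d)) = 1 := by
  rw [volume_pi, Measure.pi_univ]
  simp

/-- The translate `x + s eᵢ` of a point `x` of the torus in the `i`-th coordinate direction. -/
noncomputable def torusShift {d : ℕ} (i : Fin d) (x : Torus d) (s : ℝ) : Torus d :=
  x + Pi.single i (s : UnitAddCircle)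

/-- The `i`-th partial derivative of a function on the torus. -/
noncomputable def torusPartial {d : ℕ} (i : Fin d) (f : Torus d → ℝ) (x : Torus d) : ℝ :=
  deriv (fun s : ℝ => f (torusShift i x s)) 0

/-- The Laplacian `Δf = ∑ᵢ ∂ᵢ∂ᵢf` on the torus. -/
noncomputable def torusLaplacian {d : ℕ} (f : Torus d → ℝ) (x : Torus d) : ℝ :=
  ∑ i, torusPartial i (torusPartial i f) x

/-- `u ∈ C^{1,2}((0,∞) × T^d)`: the derivatives `∂ₜu`, `∂ᵢu`, `∂ᵢ∂ⱼu` exist at all positive times,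
and together with `u` they are jointly continuous on `(0,∞) × T^d`. -/
structure IsC12 {d : ℕ} (u : ℝ → Torus d → ℝ) : Prop where
  diff_t : ∀ t > 0, ∀ x, DifferentiableAt ℝ (fun s => u s x) t
  diff_x : ∀ t > 0, ∀ x, ∀ i : Fin d,
    DifferentiableAt ℝ (fun s : ℝ => u t (torusShift i x s)) 0
  diff_xx : ∀ t > 0, ∀ x, ∀ i j : Fin d,
    DifferentiableAt ℝ (fun s : ℝ => torusPartial j (u t) (torusShift i x s)) 0
  cont : ContinuousOn (fun z : ℝ × Torus d => u z.1 z.2) (Ioi 0 ×ˢ univ)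
  cont_t : ContinuousOn (fun z : ℝ × Torus d => deriv (fun s => u s z.2) z.1) (Ioi 0 ×ˢ univ)
  cont_x : ∀ i : Fin d,
    ContinuousOn (fun z : ℝ × Torus d => torusPartial i (u z.1) z.2) (Ioi 0 ×ˢ univ)
  cont_xx : ∀ i j : Fin d,
    ContinuousOn (fun z : ℝ × Torus d => torusPartial i (torusPartial j (u z.1)) z.2)
      (Ioi 0 ×ˢ univ)

/-- The regularity class of one component of a global classical solution whose initial value `u 0`
is merely bounded: `u` is `C^{1,2}` at positive times, bounded on `(0,T] × T^d` for every finite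
`T`, and takes its initial value in the sense of `L¹`. -/
structure IsClassicalComponent {d : ℕ} (u : ℝ → Torus d → ℝ) : Prop where
  regular : IsC12 u
  locally_bounded : ∀ T : ℝ, ∃ M : ℝ, ∀ t ∈ Ioc 0 T, ∀ x, |u t x| ≤ M
  initial : Tendsto (fun t => eLpNorm (fun x => u t x - u 0 x) 1 volume) (𝓝[>] 0) (𝓝 0)

/-- `(n, p, e)` is a global classical solution, with initial value `(n 0, p 0, e 0)`, of
`∂ₜn = κΔn + k(e - np)`, `∂ₜp = κΔp + k(e - np)`, `∂ₜe = κΔe` on the torus.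
Here `k t x` is the value of the reaction coefficient at `(t, x)`; a coefficient `K(x, n, p, e)` is
the case `k t x = K x (n t x) (p t x) (e t x)`. No sign of `n`, `p`, `e` is presupposed. -/
structure IsGlobalSolution {d : ℕ} (κ : ℝ) (k n p e : ℝ → Torus d → ℝ) : Prop where
  comp_n : IsClassicalComponent n
  comp_p : IsClassicalComponent p
  comp_e : IsClassicalComponent e
  eq_n : ∀ t > 0, ∀ x, deriv (fun s => n s x) t =
    κ * torusLaplacian (n t) x + k t x * (e t x - n t x * p t x)
  eq_p : ∀ t > 0, ∀ x, deriv (fun s => p s x) t =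
    κ * torusLaplacian (p t) x + k t x * (e t x - n t x * p t x)
  eq_e : ∀ t > 0, ∀ x, deriv (fun s => e s x) t = κ * torusLaplacian (e t) x

/-- The Boltzmann function `λ_B(ν) = ν log ν - ν + 1`, with `λ_B(0) = 1`. -/
noncomputable def boltzmann (ν : ℝ) : ℝ := ν * Real.log ν - ν + 1

/-- The relative entropy with respect to the constant state `(Cn √eStar, Cp √eStar, eStar)`:
the integral over the torus of
`w_n λ_B(n / w_n) + w_p λ_B(p / w_p) + (c + Cn + Cp) / (2 √eStar) (√e - √eStar)²`
with `w_n = Cn √e` and `w_p = Cp √e`. The integrand is nonnegative for nonnegative `n`, `p` and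
positive `e`, so that the integral is an element of `[0, ∞]`. -/
noncomputable def relEntropy {d : ℕ} (c Cn Cp eStar : ℝ) (n p e : Torus d → ℝ) : ENNReal :=
  ∫⁻ x, ENNReal.ofReal
    (Cn * √(e x) * boltzmann (n x / (Cn * √(e x))) +
      Cp * √(e x) * boltzmann (p x / (Cp * √(e x))) +
      (c + Cn + Cp) / (2 * √eStar) * (√(e x) - √eStar) ^ 2)

/-! The `L¹` bound follows from a pointwise bound uniform in time, because the torus has measure
one. Both `e` and `n - p` solve the heat equation, so `0 ≤ e ≤ B` and `n - p ≤ A` persist from the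
initial data. Where `n > A + B + 1`, also `p ≥ n - A > B`, hence `n p ≥ B ≥ e`: the reaction term is
nonpositive and `n` cannot cross this level. Likewise `n ≥ 0` persists, and exchanging `n` and `p`
bounds `p`.

Each of these bounds is an instance of `IsClassicalComponent.le_of_initial_le`. Its proof shows that
`y(t) = ∫ (u - K)₊³` satisfies `y' ≤ 3 L y` and tends to `0` as `t → 0⁺`, so that `y = 0`. -/

/-! ### Translations and partial derivatives on the torus -/

theorem torusShift_add {d : ℕ} (i : Fin d) (x : Torus d) (s h : ℝ) :
    torusShift i x (s + h) = torusShift i (torusShift i x s) h := by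
  simp only [torusShift, add_assoc, ← Pi.single_add]
  rfl

theorem torusShift_zero {d : ℕ} (i : Fin d) (x : Torus d) : torusShift i x 0 = x := by
  have h : ((0 : ℝ) : UnitAddCircle) = 0 := rfl
  simp [torusShift, h]

theorem hasDerivAt_torusShift {d : ℕ} {i : Fin d} {f : Torus d → ℝ}
    (hf : ∀ x, DifferentiableAt ℝ (fun s : ℝ => f (torusShift i x s)) 0) (x : Torus d) (s : ℝ) :
    HasDerivAt (fun s : ℝ => f (torusShift i x s)) (torusPartial i f (torusShift i x s)) s := by
  have h := (hf (torusShift i x s)).hasDerivAt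
  have h2 : HasDerivAt (fun r : ℝ => f (torusShift i (torusShift i x s) (r - s)))
      (torusPartial i f (torusShift i x s)) s := by
    rw [← sub_self s] at h
    have h3 := h.comp_sub_const s s
    simpa [torusPartial] using h3
  refine h2.congr_of_eventuallyEq (Eventually.of_forall fun r => ?_)
  simp only [← torusShift_add, add_sub_cancel]

theorem HasDerivAt.torusPartial_eq {d : ℕ} {i : Fin d} {f : Torus d → ℝ} {x : Torus d} {c : ℝ}
    (h : HasDerivAt (fun s : ℝ => f (torusShift i x s)) c 0) : torusPartial i f x = c :=
  h.deriv

/-- The integral of a partial derivative over the torus vanishes, by translation invariance. -/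
theorem integral_torusPartial {d : ℕ} {i : Fin d} {f : Torus d → ℝ} (hc : Continuous f)
    (hf : ∀ x, DifferentiableAt ℝ (fun s : ℝ => f (torusShift i x s)) 0)
    (hc' : Continuous (torusPartial i f)) : ∫ x, torusPartial i f x = 0 := by
  have hsh : ∀ s, Continuous fun x : Torus d => torusShift i x s := fun s => by
    unfold torusShift; fun_prop
  obtain ⟨C, hC⟩ := (isCompact_range hc').isBounded.exists_norm_le
  have key := hasDerivAt_integral_of_dominated_loc_of_deriv_le (μ := (volume : Measure (Torus d)))
    (F := fun s x => f (torusShift i x s)) (F' := fun s x => torusPartial i f (torusShift i x s))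
    (x₀ := (0 : ℝ)) (s := univ) (bound := fun _ => C) univ_mem
    (Eventually.of_forall fun s => (hc.comp (hsh s)).aestronglyMeasurable)
    ((hc.comp (hsh 0)).integrable_of_hasCompactSupport (HasCompactSupport.of_compactSpace _))
    ((hc'.comp (hsh 0)).aestronglyMeasurable)
    (Eventually.of_forall fun x s _ => hC _ (mem_range_self _))
    (integrable_const C)
    (Eventually.of_forall fun x s _ => hasDerivAt_torusShift hf x s)
  have hconst : (fun s : ℝ => ∫ x, f (torusShift i x s)) = fun _ => ∫ x, f x := by
    funext s
    exact integral_add_right_eq_self f _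
  rw [hconst] at key
  simpa [torusShift_zero] using key.2.unique (hasDerivAt_const _ _)

theorem Continuous.integrable_torus {d : ℕ} {f : Torus d → ℝ} (hf : Continuous f) :
    Integrable f volume :=
  hf.integrable_of_hasCompactSupport (HasCompactSupport.of_compactSpace _)

theorem ContinuousOn.torus_slice {d : ℕ} {F : ℝ × Torus d → ℝ}
    (hF : ContinuousOn F (Ioi 0 ×ˢ univ)) {t : ℝ} (ht : 0 < t) : Continuous fun x => F (t, x) :=
  hF.comp_continuous (by fun_prop) fun x => ⟨ht, mem_univ x⟩

/-! ### Energy identities and linearity for `C^{1,2}` functions -/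

namespace IsC12

variable {d : ℕ} {u v : ℝ → Torus d → ℝ}

theorem continuous_slice (hu : IsC12 u) {t : ℝ} (ht : 0 < t) : Continuous (u t) :=
  hu.cont.torus_slice ht

theorem continuous_deriv (hu : IsC12 u) {t : ℝ} (ht : 0 < t) :
    Continuous fun x => deriv (fun s => u s x) t :=
  hu.cont_t.torus_slice ht

theorem continuous_partial (hu : IsC12 u) {t : ℝ} (ht : 0 < t) (i : Fin d) :
    Continuous (torusPartial i (u t)) :=
  (hu.cont_x i).torus_slice ht

theorem continuous_partial_partial (hu : IsC12 u) {t : ℝ} (ht : 0 < t) (i j : Fin d) :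
    Continuous (torusPartial i (torusPartial j (u t))) :=
  (hu.cont_xx i j).torus_slice ht

theorem continuous_laplacian (hu : IsC12 u) {t : ℝ} (ht : 0 < t) :
    Continuous (torusLaplacian (u t)) :=
  continuous_finsetSum _ fun i _ => hu.continuous_partial_partial ht i i

/-- Integration by parts: `∫ ψ(u) Δu = -∫ ψ'(u) |∇u|² ≤ 0` for nondecreasing `ψ`. -/
theorem integral_comp_mul_laplacian_nonpos (hu : IsC12 u) {t : ℝ} (ht : 0 < t) {ψ ψ' : ℝ → ℝ}
    (hψ : ∀ s, HasDerivAt ψ (ψ' s) s) (hψc : Continuous ψ') (hψn : ∀ s, 0 ≤ ψ' s) :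
    ∫ x, ψ (u t x) * torusLaplacian (u t) x ≤ 0 := by
  have hψ0 : Continuous ψ := continuous_iff_continuousAt.2 fun s => (hψ s).continuousAt
  have cu := hu.continuous_slice ht
  have main : ∀ i, ∫ x, ψ (u t x) * torusPartial i (torusPartial i (u t)) x ≤ 0 := by
    intro i
    have c1 := hu.continuous_partial ht i
    have c2 := hu.continuous_partial_partial ht i i
    have hd : ∀ x, HasDerivAt
        (fun s : ℝ => (fun y => ψ (u t y) * torusPartial i (u t) y) (torusShift i x s))
        (ψ' (u t x) * torusPartial i (u t) x * torusPartial i (u t) x +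
          ψ (u t x) * torusPartial i (torusPartial i (u t)) x) 0 := by
      intro x
      have h1 := hasDerivAt_torusShift (fun x => hu.diff_x t ht x i) x 0
      have h2 := hasDerivAt_torusShift (fun x => hu.diff_xx t ht x i i) x 0
      have h3 := ((hψ _).comp (0 : ℝ) h1).mul h2
      simp only [torusShift_zero, Function.comp_apply] at h3
      exact h3
    have he : torusPartial i (fun y => ψ (u t y) * torusPartial i (u t) y) = fun x =>
        ψ' (u t x) * torusPartial i (u t) x * torusPartial i (u t) x +
          ψ (u t x) * torusPartial i (torusPartial i (u t)) x :=
      funext fun x => (hd x).torusPartial_eq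
    have h0 := integral_torusPartial (i := i) (f := fun y => ψ (u t y) * torusPartial i (u t) y)
      (by fun_prop) (fun x => (hd x).differentiableAt) (by rw [he]; fun_prop)
    rw [he, integral_add (Continuous.integrable_torus (by fun_prop))
      (Continuous.integrable_torus (by fun_prop))] at h0
    have h1 : 0 ≤ ∫ x, ψ' (u t x) * torusPartial i (u t) x * torusPartial i (u t) x :=
      integral_nonneg fun x =>
        (mul_nonneg (hψn _) (mul_self_nonneg _)).trans_eq (mul_assoc _ _ _).symm
    linarith
  simp only [torusLaplacian, Finset.mul_sum]
  rw [integral_finsetSum _ fun i _ => ?_]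
  · exact Finset.sum_nonpos fun i _ => main i
  · have := hu.continuous_partial_partial ht i i
    exact Continuous.integrable_torus (by fun_prop)

theorem hasDerivAt_integral_comp (hu : IsC12 u) {t : ℝ} (ht : 0 < t) {φ ψ : ℝ → ℝ}
    (hφ : ∀ s, HasDerivAt φ (ψ s) s) (hψ : Continuous ψ) :
    HasDerivAt (fun t => ∫ x, φ (u t x)) (∫ x, ψ (u t x) * deriv (fun s => u s x) t) t := by
  have hφc : Continuous φ := continuous_iff_continuousAt.2 fun s => (hφ s).continuousAt
  -- A compact time interval around `t` that avoids `0`, where continuity may fail, supplies a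
  -- constant dominating function.
  have hcF : ContinuousOn (fun z : ℝ × Torus d => ψ (u z.1 z.2) * deriv (fun s => u s z.2) z.1)
      (Icc (t / 2) (2 * t) ×ˢ univ) :=
    ((hψ.comp_continuousOn hu.cont).mul hu.cont_t).mono
      (prod_mono (fun s hs => lt_of_lt_of_le (by positivity) hs.1) subset_rfl)
  obtain ⟨C, hC⟩ := (isCompact_Icc.prod isCompact_univ).exists_bound_of_continuousOn hcF
  refine (hasDerivAt_integral_of_dominated_loc_of_deriv_le
    (F := fun s x => φ (u s x)) (F' := fun s x => ψ (u s x) * deriv (fun r => u r x) s)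
    (s := Icc (t / 2) (2 * t)) (bound := fun _ => C)
    (Icc_mem_nhds (by linarith) (by linarith)) ?_ ?_ ?_ ?_ (integrable_const C) ?_).2
  · filter_upwards [Ioi_mem_nhds ht] with s hs
    exact (hφc.comp (hu.continuous_slice hs)).aestronglyMeasurable
  · exact (hφc.comp (hu.continuous_slice ht)).integrable_torus
  · exact ((hψ.comp (hu.continuous_slice ht)).mul (hu.continuous_deriv ht)).aestronglyMeasurable
  · exact Eventually.of_forall fun x s hs => hC (s, x) ⟨hs, mem_univ x⟩
  · refine Eventually.of_forall fun x s hs => (hφ _).comp s (hu.diff_t s ?_ x).hasDerivAt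
    exact lt_of_lt_of_le (by positivity) hs.1

theorem torusPartial_linear_comb (hu : IsC12 u) (hv : IsC12 v) (a b : ℝ) {t : ℝ} (ht : 0 < t)
    (i : Fin d) : torusPartial i (fun x => a * u t x + b * v t x) =
      fun x => a * torusPartial i (u t) x + b * torusPartial i (v t) x :=
  funext fun x => HasDerivAt.torusPartial_eq
    (((hu.diff_x t ht x i).hasDerivAt.const_mul a).add
      ((hv.diff_x t ht x i).hasDerivAt.const_mul b))

theorem torusPartial_torusPartial_linear_comb (hu : IsC12 u) (hv : IsC12 v) (a b : ℝ) {t : ℝ}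
    (ht : 0 < t) (i j : Fin d) :
    torusPartial i (torusPartial j (fun x => a * u t x + b * v t x)) = fun x =>
      a * torusPartial i (torusPartial j (u t)) x +
        b * torusPartial i (torusPartial j (v t)) x := by
  rw [hu.torusPartial_linear_comb hv a b ht]
  exact funext fun x => HasDerivAt.torusPartial_eq
    (((hu.diff_xx t ht x i j).hasDerivAt.const_mul a).add
      ((hv.diff_xx t ht x i j).hasDerivAt.const_mul b))

theorem torusLaplacian_linear_comb (hu : IsC12 u) (hv : IsC12 v) (a b : ℝ) {t : ℝ} (ht : 0 < t)
    (x : Torus d) : torusLaplacian (fun x => a * u t x + b * v t x) x =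
      a * torusLaplacian (u t) x + b * torusLaplacian (v t) x := by
  simp only [torusLaplacian, hu.torusPartial_torusPartial_linear_comb hv a b ht,
    Finset.sum_add_distrib, Finset.mul_sum]

theorem deriv_linear_comb (hu : IsC12 u) (hv : IsC12 v) (a b : ℝ) {t : ℝ} (ht : 0 < t)
    (x : Torus d) : deriv (fun s => a * u s x + b * v s x) t =
      a * deriv (fun s => u s x) t + b * deriv (fun s => v s x) t :=
  (((hu.diff_t t ht x).hasDerivAt.const_mul a).add
    ((hv.diff_t t ht x).hasDerivAt.const_mul b)).deriv

theorem linear_comb (hu : IsC12 u) (hv : IsC12 v) (a b : ℝ) :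
    IsC12 fun t x => a * u t x + b * v t x where
  diff_t t ht x := ((hu.diff_t t ht x).const_mul a).add ((hv.diff_t t ht x).const_mul b)
  diff_x t ht x i := ((hu.diff_x t ht x i).const_mul a).add ((hv.diff_x t ht x i).const_mul b)
  diff_xx t ht x i j := by
    simp only [hu.torusPartial_linear_comb hv a b ht]
    exact ((hu.diff_xx t ht x i j).const_mul a).add ((hv.diff_xx t ht x i j).const_mul b)
  cont := (hu.cont.const_mul a).add (hv.cont.const_mul b)
  cont_t := ((hu.cont_t.const_mul a).add (hv.cont_t.const_mul b)).congr fun z hz =>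
    hu.deriv_linear_comb hv a b hz.1 z.2
  cont_x i := (((hu.cont_x i).const_mul a).add ((hv.cont_x i).const_mul b)).congr fun z hz =>
    congrFun (hu.torusPartial_linear_comb hv a b hz.1 i) z.2
  cont_xx i j := (((hu.cont_xx i j).const_mul a).add ((hv.cont_xx i j).const_mul b)).congr
    fun z hz => congrFun (hu.torusPartial_torusPartial_linear_comb hv a b hz.1 i j) z.2

end IsC12

/-! ### Truncation and the weak maximum principle -/

/-- Powers of at least two smooth the kink. The cube is the power used below: its derivative is
again differentiable, with continuous derivative, as integration by parts requires. -/
theorem hasDerivAt_posPart_pow (K : ℝ) (m : ℕ) (s : ℝ) :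
    HasDerivAt (fun s => max (s - K) 0 ^ (m + 2)) ((m + 2) * max (s - K) 0 ^ (m + 1)) s := by
  rcases lt_trichotomy s K with h | rfl | h
  · have h0 : max (s - K) 0 = 0 := max_eq_right (by linarith)
    rw [h0, zero_pow (by omega), mul_zero]
    refine (hasDerivAt_const s (0 : ℝ)).congr_of_eventuallyEq ?_
    filter_upwards [Iio_mem_nhds h] with r hr
    rw [max_eq_right (by linarith [mem_Iio.1 hr]), zero_pow (by omega)]
  · simp only [sub_self, max_self]
    rw [zero_pow (by omega), mul_zero, hasDerivAt_iff_hasFDerivAt]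
    have : HasFDerivAt (fun r => max (r - s) 0 ^ (m + 2)) (0 : ℝ →L[ℝ] ℝ) s := by
      -- At the kink the function is `O(|r - s|^(m + 2))` with exponent above one, so its derivative
      -- is zero.
      refine Asymptotics.IsBigO.hasFDerivAt (n := m + 2) ?_ (by omega)
      refine Asymptotics.IsBigO.of_bound 1 (Eventually.of_forall fun r => ?_)
      rw [one_mul, norm_pow, norm_pow, norm_norm]
      gcongr
      rw [Real.norm_of_nonneg (le_max_right _ _)]
      exact max_le (le_abs_self _) (abs_nonneg _)
    simpa using this
  · have h0 : max (s - K) 0 = s - K := max_eq_left (by linarith)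
    rw [h0]
    have h1 := ((hasDerivAt_id' s).sub_const K).fun_pow (m + 2)
    refine HasDerivAt.congr_of_eventuallyEq (f := fun r => (r - K) ^ (m + 2)) ?_ ?_
    · refine h1.congr_deriv ?_
      push_cast
      simp
    · filter_upwards [Ioi_mem_nhds h] with r hr
      rw [max_eq_left (by linarith [mem_Ioi.1 hr])]

namespace IsClassicalComponent

variable {d : ℕ} {u v : ℝ → Torus d → ℝ}

theorem linear_comb (hu : IsClassicalComponent u) (hv : IsClassicalComponent v) (a b : ℝ)
    (hu0 : AEStronglyMeasurable (u 0) volume) (hv0 : AEStronglyMeasurable (v 0) volume) :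
    IsClassicalComponent fun t x => a * u t x + b * v t x where
  regular := hu.regular.linear_comb hv.regular a b
  locally_bounded T := by
    obtain ⟨M, hM⟩ := hu.locally_bounded T
    obtain ⟨N, hN⟩ := hv.locally_bounded T
    refine ⟨|a| * M + |b| * N, fun t ht x => (abs_add_le _ _).trans ?_⟩
    rw [abs_mul, abs_mul]
    gcongr
    exacts [hM t ht x, hN t ht x]
  initial := by
    have h := (ENNReal.Tendsto.const_mul hu.initial (.inr (enorm_ne_top (x := a)))).add
      (ENNReal.Tendsto.const_mul hv.initial (.inr (enorm_ne_top (x := b))))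
    simp only [mul_zero, add_zero] at h
    refine tendsto_of_tendsto_of_tendsto_of_le_of_le' tendsto_const_nhds h
      (Eventually.of_forall fun _ => zero_le) ?_
    filter_upwards [self_mem_nhdsWithin] with t ht
    have mu := (hu.regular.continuous_slice ht).aestronglyMeasurable (μ := volume) |>.sub hu0
    have mv := (hv.regular.continuous_slice ht).aestronglyMeasurable (μ := volume) |>.sub hv0
    rw [← eLpNorm_const_smul, ← eLpNorm_const_smul]
    refine le_trans (le_of_eq ?_) (eLpNorm_add_le (mu.const_smul a) (mv.const_smul b) le_rfl)
    congr 1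
    funext x
    simp only [Pi.add_apply, Pi.smul_apply, smul_eq_mul]
    ring

/-- Since `u 0 ≤ K`, one factor `(u - K)₊` is at most `|u t - u 0|`; local boundedness controls the
other two. Thus `L¹` convergence suffices. -/
theorem tendsto_integral_posPart_pow (hu : IsClassicalComponent u) {K : ℝ}
    (h0 : ∀ᵐ x, u 0 x ≤ K) :
    Tendsto (fun t => ∫ x, max (u t x - K) 0 ^ 3) (𝓝[>] 0) (𝓝 0) := by
  obtain ⟨M, hM⟩ := hu.locally_bounded 1
  set C : ℝ := (|M| + |K|) ^ 2
  have h := ENNReal.Tendsto.const_mul hu.initial (.inr (ENNReal.ofReal_ne_top (r := C)))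
  rw [mul_zero] at h
  have h2 := (ENNReal.tendsto_toReal ENNReal.zero_ne_top).comp h
  refine squeeze_zero' (Eventually.of_forall fun t => integral_nonneg fun x => by positivity) ?_ h2
  -- Finiteness is needed because `toReal` sends `⊤` to `0`.
  have hfin : ∀ᶠ t in 𝓝[>] (0 : ℝ),
      ENNReal.ofReal C * eLpNorm (fun x => u t x - u 0 x) 1 volume < ⊤ :=
    h.eventually_lt_const ENNReal.zero_lt_top
  filter_upwards [hfin, Ioc_mem_nhdsGT zero_lt_one] with t hft ht
  have hcu := hu.regular.continuous_slice ht.1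
  rw [Function.comp_apply, ← ENNReal.ofReal_le_iff_le_toReal hft.ne,
    ofReal_integral_eq_lintegral_ofReal (Continuous.integrable_torus (by fun_prop))
      (Eventually.of_forall fun x => by positivity),
    eLpNorm_one_eq_lintegral_enorm, ← lintegral_const_mul' _ _ ENNReal.ofReal_ne_top]
  refine lintegral_mono_ae ?_
  filter_upwards [h0] with x hx
  rw [Real.enorm_eq_ofReal_abs, ← ENNReal.ofReal_mul (by positivity), pow_succ]
  refine ENNReal.ofReal_le_ofReal ?_
  have h1 : max (u t x - K) 0 ≤ |M| + |K| :=
    max_le (by linarith [le_abs_self (u t x), hM t ht x, le_abs_self M, neg_abs_le K])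
      (by positivity)
  exact mul_le_mul (pow_le_pow_left₀ (le_max_right _ _) h1 2)
    (max_le (by linarith [le_abs_self (u t x - u 0 x)]) (abs_nonneg _))
    (le_max_right _ _) (by positivity)

/-- Weak maximum principle, by truncation: an upper bound `K` of the initial values persists if
`u` is a subsolution of `∂ₜu = κΔu + L(u - K)` wherever it exceeds `K`. -/
theorem le_of_initial_le (hu : IsClassicalComponent u) {κ K L T : ℝ} (hκ : 0 ≤ κ)
    (h0 : ∀ᵐ x, u 0 x ≤ K)
    (hsub : ∀ t ∈ Ioo 0 T, ∀ x, K < u t x →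
      deriv (fun s => u s x) t ≤ κ * torusLaplacian (u t) x + L * (u t x - K))
    {t : ℝ} (ht : t ∈ Ioo 0 T) (x : Torus d) : u t x ≤ K := by
  set y : ℝ → ℝ := fun t => ∫ x, max (u t x - K) 0 ^ 3
  have hφ : ∀ s, HasDerivAt (fun s => max (s - K) 0 ^ 3) (3 * max (s - K) 0 ^ 2) s := fun s =>
    (hasDerivAt_posPart_pow K 1 s).congr_deriv (by norm_num)
  have hψ : ∀ s, HasDerivAt (fun s => 3 * max (s - K) 0 ^ 2) (3 * (2 * max (s - K) 0)) s :=
    fun s => ((hasDerivAt_posPart_pow K 0 s).const_mul 3).congr_deriv (by norm_num)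
  have hderiv : ∀ s > 0, HasDerivAt y
      (∫ x, 3 * max (u s x - K) 0 ^ 2 * deriv (fun r => u r x) s) s := fun s hs =>
    hu.regular.hasDerivAt_integral_comp hs hφ (by fun_prop)
  have hle : ∀ s ∈ Ioo 0 T,
      ∫ x, 3 * max (u s x - K) 0 ^ 2 * deriv (fun r => u r x) s ≤ 3 * L * y s := by
    intro s hs
    have cu := hu.regular.continuous_slice hs.1
    have cd := hu.regular.continuous_deriv hs.1
    have cl := hu.regular.continuous_laplacian hs.1
    have hneg := hu.regular.integral_comp_mul_laplacian_nonpos hs.1 hψ (by fun_prop)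
      (fun s => by positivity)
    calc ∫ x, 3 * max (u s x - K) 0 ^ 2 * deriv (fun r => u r x) s
        ≤ ∫ x, (κ * (3 * max (u s x - K) 0 ^ 2 * torusLaplacian (u s) x) +
            3 * L * max (u s x - K) 0 ^ 3) := by
          refine integral_mono (Continuous.integrable_torus (by fun_prop))
            (Continuous.integrable_torus (by fun_prop)) fun x => ?_
          rcases le_or_gt (u s x) K with h | h
          · simp [max_eq_right (sub_nonpos.2 h)]
          · simp only [max_eq_left (sub_pos.2 h).le]
            calc 3 * (u s x - K) ^ 2 * deriv (fun r => u r x) s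
                ≤ 3 * (u s x - K) ^ 2 * (κ * torusLaplacian (u s) x + L * (u s x - K)) :=
                  mul_le_mul_of_nonneg_left (hsub s hs x h) (by positivity)
              _ = _ := by ring
      _ = κ * (∫ x, 3 * max (u s x - K) 0 ^ 2 * torusLaplacian (u s) x) + 3 * L * y s := by
          rw [integral_add (Continuous.integrable_torus (by fun_prop))
            (Continuous.integrable_torus (by fun_prop)), integral_const_mul, integral_const_mul]
      _ ≤ 3 * L * y s := by linarith [mul_nonpos_of_nonneg_of_nonpos hκ hneg]
  -- Grönwall's argument with an integrating factor, on the open interval because `y` is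
  -- differentiated only at positive times.
  have hanti : AntitoneOn (fun s => Real.exp (-(3 * L) * s) * y s) (Ioo 0 T) := by
    have hd : ∀ s ∈ Ioo 0 T, HasDerivAt (fun s => Real.exp (-(3 * L) * s) * y s)
        (Real.exp (-(3 * L) * s) * (-(3 * L) * 1) * y s + Real.exp (-(3 * L) * s) *
          ∫ x, 3 * max (u s x - K) 0 ^ 2 * deriv (fun r => u r x) s) s := fun s hs =>
      (((hasDerivAt_id s).const_mul _).exp).mul (hderiv s hs.1)
    refine antitoneOn_of_deriv_nonpos (convex_Ioo 0 T)
      (fun s hs => (hd s hs).continuousAt.continuousWithinAt)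
      (fun s hs => (hd s (interior_subset hs)).differentiableAt.differentiableWithinAt)
      fun s hs => ?_
    have hs := interior_subset hs
    rw [(hd s hs).deriv]
    have := mul_le_mul_of_nonneg_left (hle s hs) (Real.exp_pos (-(3 * L) * s)).le
    linarith
  have hlim : Tendsto (fun s => Real.exp (-(3 * L) * s) * y s) (𝓝[>] 0) (𝓝 0) := by
    have h1 : Tendsto (fun s : ℝ => Real.exp (-(3 * L) * s)) (𝓝[>] 0)
        (𝓝 (Real.exp (-(3 * L) * 0))) :=
      Continuous.tendsto (by fun_prop) 0 |>.mono_left nhdsWithin_le_nhds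
    simpa using h1.mul (hu.tendsto_integral_posPart_pow h0)
  have hle0 : Real.exp (-(3 * L) * t) * y t ≤ 0 := by
    refine ge_of_tendsto hlim ?_
    filter_upwards [Ioo_mem_nhdsGT ht.1] with s hs
    exact hanti ⟨hs.1, hs.2.trans ht.2⟩ ht hs.2.le
  have cu := hu.regular.continuous_slice ht.1
  have hnn : 0 ≤ fun x => max (u t x - K) 0 ^ 3 := fun x => by positivity
  have hy0 : y t = 0 :=
    le_antisymm (nonpos_of_mul_nonpos_right hle0 (Real.exp_pos _)) (integral_nonneg hnn)
  have hae := (integral_eq_zero_iff_of_nonneg hnn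
    (Continuous.integrable_torus (by fun_prop))).1 hy0
  -- Haar measure charges every nonempty open set, so continuity upgrades a.e. vanishing to
  -- vanishing everywhere.
  have hall := Continuous.ae_eq_iff_eq (μ := volume) (by fun_prop) continuous_zero |>.1 hae
  have hx := pow_eq_zero_iff (by norm_num) |>.1 (congrFun hall x)
  linarith [le_max_left (u t x - K) 0]

end IsClassicalComponent

/-! ### Pointwise bounds for solutions -/

theorem MeasureTheory.MemLp.exists_ae_abs_le {α : Type*} [MeasurableSpace α] {μ : Measure α}
    {f : α → ℝ} (hf : MemLp f ⊤ μ) : ∃ A, 0 ≤ A ∧ ∀ᵐ x ∂μ, |f x| ≤ A := by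
  refine ⟨(eLpNorm f ⊤ μ).toReal, ENNReal.toReal_nonneg, ?_⟩
  filter_upwards [ae_le_eLpNormEssSup (f := f) (μ := μ)] with x hx
  rw [← eLpNorm_exponent_top, Real.enorm_eq_ofReal_abs] at hx
  exact (ENNReal.ofReal_le_iff_le_toReal hf.2.ne).1 hx

namespace IsGlobalSolution

variable {d : ℕ} {κ kUp : ℝ} {k n p e : ℝ → Torus d → ℝ}

/-- The equations are symmetric in `n` and `p`. -/
theorem swap (h : IsGlobalSolution κ k n p e) : IsGlobalSolution κ k p n e where
  comp_n := h.comp_p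
  comp_p := h.comp_n
  comp_e := h.comp_e
  eq_n t ht x := by rw [h.eq_p t ht x, mul_comm (p t x)]
  eq_p t ht x := by rw [h.eq_n t ht x, mul_comm (p t x)]
  eq_e := h.eq_e

theorem e_le (h : IsGlobalSolution κ k n p e) (hκ : 0 ≤ κ) {K : ℝ} (h0 : ∀ᵐ x, e 0 x ≤ K)
    {t : ℝ} (ht : 0 < t) (x : Torus d) : e t x ≤ K :=
  h.comp_e.le_of_initial_le (L := 0) (T := t + 1) hκ h0
    (fun s hs x _ => by rw [h.eq_e s hs.1 x]; linarith) ⟨ht, by linarith⟩ x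

theorem e_nonneg (h : IsGlobalSolution κ k n p e) (hκ : 0 ≤ κ)
    (hm : AEStronglyMeasurable (e 0) volume) (h0 : ∀ᵐ x, 0 ≤ e 0 x)
    {t : ℝ} (ht : 0 < t) (x : Torus d) : 0 ≤ e t x := by
  have hr := h.comp_e.regular
  -- The coefficients `-1, 0` produce `-e`, turning the lower bound into an upper one.
  have := (h.comp_e.linear_comb h.comp_e (-1) 0 hm hm).le_of_initial_le (K := 0) (L := 0)
    (T := t + 1) hκ (by filter_upwards [h0] with x hx; linarith)
    (fun s hs x _ => by
      rw [hr.deriv_linear_comb hr _ _ hs.1, hr.torusLaplacian_linear_comb hr _ _ hs.1,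
        h.eq_e s hs.1 x]
      linarith) ⟨ht, by linarith⟩ x
  linarith

/-- The reaction term for `-n` is `-k e + k (-p) (-n)`. Where `-n > 0` it is at most `kUp * M *
(-n)`, with `M` bounding `|p|` up to time `t + 1`; no sign of `p` is needed, and `M` may depend on
`t`. -/
theorem n_nonneg (h : IsGlobalSolution κ k n p e) (hκ : 0 ≤ κ)
    (hk : ∀ t > 0, ∀ x, 0 ≤ k t x ∧ k t x ≤ kUp) (he : ∀ t > 0, ∀ x, 0 ≤ e t x)
    (hm : AEStronglyMeasurable (n 0) volume) (h0 : ∀ᵐ x, 0 ≤ n 0 x)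
    {t : ℝ} (ht : 0 < t) (x : Torus d) : 0 ≤ n t x := by
  have hr := h.comp_n.regular
  obtain ⟨M, hM⟩ := h.comp_p.locally_bounded (t + 1)
  have := (h.comp_n.linear_comb h.comp_n (-1) 0 hm hm).le_of_initial_le (K := 0) (L := kUp * M)
    (T := t + 1) hκ (by filter_upwards [h0] with x hx; linarith)
    (fun s hs x hx => by
      rw [hr.deriv_linear_comb hr _ _ hs.1, hr.torusLaplacian_linear_comb hr _ _ hs.1,
        h.eq_n s hs.1 x]
      have hn : 0 ≤ -n s x := by linarith
      obtain ⟨hk0, hk1⟩ := hk s hs.1 x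
      have hp : -p s x ≤ M := (neg_le_abs _).trans (hM s ⟨hs.1, hs.2.le⟩ x)
      have hM0 : 0 ≤ M := (abs_nonneg _).trans (hM s ⟨hs.1, hs.2.le⟩ x)
      have h1 : k s x * -p s x ≤ kUp * M :=
        (mul_le_mul_of_nonneg_left hp hk0).trans (mul_le_mul_of_nonneg_right hk1 hM0)
      have h2 := mul_le_mul_of_nonneg_right h1 hn
      have h3 := mul_nonneg hk0 (he s hs.1 x)
      linarith) ⟨ht, by linarith⟩ x
  linarith

/-- The two reaction terms cancel in `n - p`. -/
theorem sub_le (h : IsGlobalSolution κ k n p e) (hκ : 0 ≤ κ)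
    (hmn : AEStronglyMeasurable (n 0) volume) (hmp : AEStronglyMeasurable (p 0) volume)
    {A : ℝ} (h0 : ∀ᵐ x, n 0 x - p 0 x ≤ A)
    {t : ℝ} (ht : 0 < t) (x : Torus d) : n t x - p t x ≤ A := by
  have hr := h.comp_n.regular
  have hr' := h.comp_p.regular
  have := (h.comp_n.linear_comb h.comp_p 1 (-1) hmn hmp).le_of_initial_le (K := A) (L := 0)
    (T := t + 1) hκ (by filter_upwards [h0] with x hx; linarith)
    (fun s hs x _ => by
      rw [hr.deriv_linear_comb hr' _ _ hs.1, hr.torusLaplacian_linear_comb hr' _ _ hs.1,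
        h.eq_n s hs.1 x, h.eq_p s hs.1 x]
      linarith) ⟨ht, by linarith⟩ x
  linarith

/-- Where `n` exceeds a large constant, so does `n p ≥ n (n - A)`, hence the reaction term is
negative there and `n` stays bounded uniformly in time. -/
theorem n_le (h : IsGlobalSolution κ k n p e) (hκ : 0 ≤ κ) (hk : ∀ t > 0, ∀ x, 0 ≤ k t x)
    {A B : ℝ} (hA : 0 ≤ A) (hB : 0 ≤ B) (he : ∀ t > 0, ∀ x, e t x ≤ B)
    (hnp : ∀ t > 0, ∀ x, n t x - p t x ≤ A) (h0 : ∀ᵐ x, n 0 x ≤ A)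
    {t : ℝ} (ht : 0 < t) (x : Torus d) : n t x ≤ A + B + 1 :=
  h.comp_n.le_of_initial_le (L := 0) (T := t + 1) hκ
    (by filter_upwards [h0] with x hx; linarith)
    (fun s hs x hx => by
      rw [h.eq_n s hs.1 x]
      have hp : B ≤ p s x := by linarith [hnp s hs.1 x]
      -- The summand `1` in the level `A + B + 1` ensures `n ≥ 1` here.
      have hmul : 1 * B ≤ n s x * p s x := mul_le_mul (by linarith) hp hB (by linarith)
      have := mul_nonneg (hk s hs.1 x)
        (sub_nonneg.2 (((he s hs.1 x).trans_eq (one_mul B).symm).trans hmul))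
      linarith) ⟨ht, by linarith⟩ x

/-- Nonnegative solutions with bounded initial values are bounded uniformly in time. -/
theorem exists_uniform_bound_n (h : IsGlobalSolution κ k n p e) (hκ : 0 ≤ κ)
    (hk : ∀ t > 0, ∀ x, 0 ≤ k t x ∧ k t x ≤ kUp)
    (hn0 : MemLp (n 0) ⊤ volume) (hp0 : MemLp (p 0) ⊤ volume) (he0 : MemLp (e 0) ⊤ volume)
    (hn : ∀ᵐ x, 0 ≤ n 0 x) (hp : ∀ᵐ x, 0 ≤ p 0 x) (he : ∀ᵐ x, 0 ≤ e 0 x) :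
    ∃ K, ∀ t > 0, ∀ x, |n t x| ≤ K := by
  obtain ⟨A, hA, hnA⟩ := hn0.exists_ae_abs_le
  obtain ⟨B, hB, heB⟩ := he0.exists_ae_abs_le
  have henn : ∀ t > 0, ∀ x, 0 ≤ e t x := fun t ht x => h.e_nonneg hκ he0.1 he ht x
  have heB' : ∀ t > 0, ∀ x, e t x ≤ B := fun t ht x =>
    h.e_le hκ (heB.mono fun x hx => (le_abs_self _).trans hx) ht x
  have hnA' : ∀ᵐ x, n 0 x ≤ A := hnA.mono fun x hx => (le_abs_self _).trans hx
  have hsub : ∀ t > 0, ∀ x, n t x - p t x ≤ A := fun t ht x =>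
    h.sub_le hκ hn0.1 hp0.1 (by filter_upwards [hnA', hp] with x h1 h2; linarith) ht x
  refine ⟨A + B + 1, fun t ht x => ?_⟩
  rw [abs_of_nonneg (h.n_nonneg hκ hk henn hn0.1 hn ht x)]
  exact h.n_le hκ (fun t ht x => (hk t ht x).1) hA hB heB' hsub hnA' ht x

end IsGlobalSolution

/-! ### From pointwise bounds to `L¹` bounds -/

theorem iSup_eLpNorm_lt_top_of_bound {d : ℕ} {u : ℝ → Torus d → ℝ} (h0 : MemLp (u 0) ⊤ volume)
    {K : ℝ} (hK : ∀ t > 0, ∀ x, |u t x| ≤ K) :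
    (⨆ (t : ℝ) (_ : 0 ≤ t), eLpNorm (u t) 1 volume) < ⊤ := by
  have h1 : eLpNorm (u 0) 1 volume < ⊤ := (h0.mono_exponent le_top).2
  refine lt_of_le_of_lt (iSup₂_le fun t ht => ?_)
    (max_lt h1 (ENNReal.ofReal_lt_top (r := K)))
  -- The pointwise bound covers only positive times; at `t = 0` the norm is finite by integrability
  -- of the initial value.
  rcases ht.eq_or_lt with rfl | ht
  · exact le_max_left _ _
  · refine le_max_of_le_right ?_
    have := eLpNorm_le_of_ae_bound (p := 1) (μ := volume)
      (Eventually.of_forall fun x => (Real.norm_eq_abs (u t x)).trans_le (hK t ht x))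
    simpa [torus_volume_univ] using this

theorem lemma5p1 {d : ℕ} (κ kLow kUp eLow eUp c C₀ E₀ Cn Cp : ℝ)
    (k n p e : ℝ → Torus d → ℝ)
    (hκ : 0 < κ) (hc : 0 ≤ c)
    -- the reaction coefficient is bounded from above and away from zero
    (hkLow : 0 < kLow) (hk : ∀ t > 0, ∀ x, kLow ≤ k t x ∧ k t x ≤ kUp)
    (hsol : IsGlobalSolution κ k n p e)
    -- nonnegative bounded initial data
    (hn0 : MemLp (n 0) ⊤ volume) (hp0 : MemLp (p 0) ⊤ volume) (he0 : MemLp (e 0) ⊤ volume)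
    (hn0_nonneg : ∀ᵐ x, 0 ≤ n 0 x) (hp0_nonneg : ∀ᵐ x, 0 ≤ p 0 x)
    -- the initial energy lies between positive constants
    (heLow : 0 < eLow) (he0_bounds : ∀ᵐ x, eLow ≤ e 0 x ∧ e 0 x ≤ eUp)
    -- the values of the conserved quantities
    (hC₀ : ∫ x, (n 0 x - p 0 x) = C₀) (hE₀ : ∫ x, e 0 x = E₀)
    -- the weights of the equilibrium `(Cn √E₀, Cp √E₀, E₀)` with the same conserved quantities
    (hCn : 0 < Cn) (hCp : Cn * Cp = 1) (hCnCp : Cn - Cp = C₀ / √E₀)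
    -- finite initial relative entropy
    (hH : relEntropy c Cn Cp E₀ (n 0) (p 0) (e 0) < ⊤) :
    (⨆ (t : ℝ) (_ : 0 ≤ t), (eLpNorm (n t) 1 volume + eLpNorm (p t) 1 volume)) < ⊤ := by
  have hk' : ∀ t > 0, ∀ x, 0 ≤ k t x ∧ k t x ≤ kUp := fun t ht x =>
    ⟨hkLow.le.trans (hk t ht x).1, (hk t ht x).2⟩
  have he : ∀ᵐ x, 0 ≤ e 0 x := he0_bounds.mono fun x hx => heLow.le.trans hx.1
  obtain ⟨K, hK⟩ :=
    hsol.exists_uniform_bound_n hκ.le hk' hn0 hp0 he0 hn0_nonneg hp0_nonneg he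
  obtain ⟨K', hK'⟩ :=
    hsol.swap.exists_uniform_bound_n hκ.le hk' hp0 hn0 he0 hp0_nonneg hn0_nonneg he
  refine lt_of_le_of_lt (iSup₂_le fun t ht => ?_) (ENNReal.add_lt_top.2
    ⟨iSup_eLpNorm_lt_top_of_bound hn0 hK, iSup_eLpNorm_lt_top_of_bound hp0 hK'⟩)
  exact add_le_add (le_iSup₂_of_le t ht le_rfl) (le_iSup₂_of_le t ht le_rfl)
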